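/- Let $\mathbb D=\{z\in\mathbb C:|z|<1\}$ and let $\mathcal A$ be the class of analytic functions $f(z)=z+\sum_{n\ge2}a_nz^n$ on $\mathbb D$; put $a_1=1$. For analytic functions $h,g$ on $\mathbb D$ write $h\prec g$ if there is an analytic function $w$ on $\mathbb D$ with $w(0)=0$, $|w(z)|\le|z|$ and $h(z)=g(w(z))$ for all $z\in\mathbb D$. Let $\mathcal C_{\mathcal B}$ be the class of all $f\in\mathcal A$ such that $$1+\frac{zf''(z)}{f'(z)}\prec\sqrt{1+\tanh z}$$ (principal branch of the square root), and for $f\in\mathcal A$ let $$H_3(1)=\begin{vmatrix}a_1&a_2&a_3\\a_2&a_3&a_4\\a_3&a_4&a_5\end{vmatrix}=2a_2a_3a_4-a_3^3-a_4^2-a_2^2a_5+a_3a_5 .$$ Then $|H_3(1)|\le \frac1{576}$ for every $f\in\mathcal C_{\mathcal B}$. The bound is sharp: the function $$f_1(z)=\int_0^z\exp\left(\int_0^t\frac{\sqrt{1+\tanh (u^3)}-1}{u}\,du\right)dt$$ belongs to $\mathcal C_{\mathcal B}$ and satisfies $|H_3(1)|=\frac1{576}$. -/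

import Mathlib

noncomputable section

namespace BeanConvex

/-- The open unit disk of the complex plane. -/
def unitDisk : Set ℂ := Metric.ball 0 1

/-- The class `𝒜` of normalized analytic functions on the open unit disk,
`f z = z + a₂ z² + a₃ z³ + ⋯`. Only the values on the disk matter. -/
def ClassA : Set (ℂ → ℂ) :=
  {f | DifferentiableOn ℂ f unitDisk ∧ f 0 = 0 ∧ deriv f 0 = 1}

/-- The `n`-th Taylor coefficient of `f` at the origin. -/
def taylorCoeff (f : ℂ → ℂ) (n : ℕ) : ℂ := iteratedDeriv n f 0 / (n.factorial : ℂ)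

/-- The Hankel determinant `H_q(n)` of `f`: the determinant of the `q × q` matrix whose entry
in row `i` and column `j` (counted from zero) is the Taylor coefficient `a_{n+i+j}`. -/
def hankelDet (q n : ℕ) (f : ℂ → ℂ) : ℂ :=
  Matrix.det (Matrix.of fun i j : Fin q => taylorCoeff f (n + (i : ℕ) + (j : ℕ)))

/-- A Schwarz function: analytic on the unit disk with `w 0 = 0` and `|w z| ≤ |z|`. -/
def IsSchwarz (w : ℂ → ℂ) : Prop :=
  DifferentiableOn ℂ w unitDisk ∧ w 0 = 0 ∧ ∀ z ∈ unitDisk, ‖w z‖ ≤ ‖z‖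

/-- Subordination `h ≺ g` of analytic functions on the unit disk. -/
def Subordinate (h g : ℂ → ℂ) : Prop :=
  DifferentiableOn ℂ h unitDisk ∧ DifferentiableOn ℂ g unitDisk ∧
    ∃ w, IsSchwarz w ∧ ∀ z ∈ unitDisk, h z = g (w z)

/-- The function `√(1 + tanh z)` (principal branch), mapping the unit disk onto a bean-shaped
domain. -/
def beanMap (z : ℂ) : ℂ := Complex.sqrt (1 + Complex.tanh z)

/-- The class `𝒞_ℬ` of all `f ∈ 𝒜` with `1 + z f''(z) / f'(z) ≺ √(1 + tanh z)`. -/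
def ClassCB : Set (ℂ → ℂ) :=
  {f | f ∈ ClassA ∧ Subordinate (fun z => 1 + z * deriv (deriv f) z / deriv f z) beanMap}

/-- The integral `∫₀ᶻ g(u) du` along the line segment from `0` to `z`. -/
def segmentIntegral (g : ℂ → ℂ) (z : ℂ) : ℂ := z * ∫ s in (0 : ℝ)..1, g ((s : ℂ) * z)

/-- The function `f₁(z) = ∫₀ᶻ exp (∫₀ᵗ (√(1 + tanh u³) - 1) / u du) dt`. The inner integrand has
a removable singularity at `u = 0` with value `0`, which is what division by zero returns. -/
def extremalFun : ℂ → ℂ :=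
  segmentIntegral fun t => Complex.exp (segmentIntegral (fun u => (beanMap (u ^ 3) - 1) / u) t)

end BeanConvex

end

/-! ### The extremal problem for the coefficients of a Schwarz function. -/

namespace BeanConvex

/-! If `w = c₁ z + c₂ z² + ⋯` is the Schwarz function of the subordination, comparing coefficients
gives `576 H₃(1) = hankelPoly c₁ c₂ c₃ c₄` (`hankelDet_eq_hankelPoly`). No sharp coefficient region
for Schwarz functions is needed: Gutzmer's inequality `∑ |cₙ|² ≤ 1` and the triangle inequality
reduce the bound to a real polynomial inequality on the unit ball (`hankel_majorant_le_one`). There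
`c₃²` has coefficient of modulus 1, so `w = z³`, the Schwarz function of `extremalFun`, attains the
bound. -/

/-- The coefficients of a Schwarz function enter the third Hankel determinant through this
polynomial, up to the factor `1 / 576`. -/
noncomputable def hankelPoly (c₁ c₂ c₃ c₄ : ℂ) : ℂ :=
  -c₃ ^ 2 + 6 / 5 * (c₂ * c₄) - 1 / 3 * c₂ ^ 3 + 7 / 10 * (c₁ * c₂ * c₃) - 3 / 5 * (c₁ ^ 2 * c₄)
    - 17 / 16 * (c₁ ^ 2 * c₂ ^ 2) + 83 / 120 * (c₁ ^ 3 * c₃) + 131 / 480 * (c₁ ^ 4 * c₂)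
    - 1157 / 11520 * c₁ ^ 6

/-- Young's inequality turns the mixed monomials into terms linear and quadratic in the squares.
Equality holds at `d = 1`, so no pure multiple of `d²` can be spent: monomials containing `d` are
split so that `d²` always comes with a factor `a²` or `b²`. -/
theorem hankel_majorant_le_one {a b d e : ℝ}
    (h : a ^ 2 + b ^ 2 + d ^ 2 + e ^ 2 ≤ 1) :
    d ^ 2 + 6 / 5 * (b * e) + 1 / 3 * b ^ 3 + 7 / 10 * (a * b * d) + 3 / 5 * (a ^ 2 * e)
      + 17 / 16 * (a ^ 2 * b ^ 2) + 83 / 120 * (a ^ 3 * d) + 131 / 480 * (a ^ 4 * b)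
      + 1157 / 11520 * a ^ 6 ≤ 1 := by
  have ha1 : a ^ 2 ≤ 1 := by nlinarith [sq_nonneg b, sq_nonneg d, sq_nonneg e]
  have young (k u v : ℝ) (hk : 0 < k) : 2 * (u * v) ≤ k * u ^ 2 + k⁻¹ * v ^ 2 := by
    have h := mul_nonneg (inv_nonneg.2 hk.le) (sq_nonneg (k * u - v))
    have h' : k⁻¹ * (k * u - v) ^ 2 = k * u ^ 2 + k⁻¹ * v ^ 2 - 2 * (u * v) := by
      field_simp
      ring
    linarith
  have h1 := young (7 / 10) b e (by norm_num)
  have h2 : 2 * b ^ 3 ≤ 1 / 2 * b ^ 2 + 2 * (b ^ 2) ^ 2 := by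
    linear_combination young (1 / 2) b (b ^ 2) (by norm_num)
  -- Here and for `a² e` below, two rival bounds are kept, so that the final search may mix them.
  have h3 : 2 * (a * b * d) ≤ 12 / 5 * (a ^ 2 * d ^ 2) + 5 / 12 * b ^ 2 := by
    linear_combination young (12 / 5) (a * d) b (by norm_num)
  have h4 : 2 * (a * b * d) ≤ 14 / 25 * a ^ 2 + 25 / 14 * (b ^ 2 * d ^ 2) := by
    linear_combination young (14 / 25) a (b * d) (by norm_num)
  have h5 : 2 * (a ^ 2 * e) ≤ 1 / 4 * a ^ 2 + 4 * (a ^ 2 * e ^ 2) := by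
    linear_combination young (1 / 4) a (a * e) (by norm_num)
  have h6 := young (7 / 5) (a ^ 2) e (by norm_num)
  have h7 : 2 * (a ^ 3 * d) ≤ (a ^ 2) ^ 2 + a ^ 2 * d ^ 2 := by
    linear_combination young 1 (a ^ 2) (a * d) (by norm_num)
  have h8 : 2 * (a ^ 4 * b) ≤ 13 / 10 * (a ^ 2) ^ 2 + 10 / 13 * (a ^ 2 * b ^ 2) := by
    linear_combination a ^ 2 * young (13 / 10) (a ^ 2) b (by norm_num)
      + 13 / 10 * a ^ 4 * ha1
  have h9 : a ^ 6 ≤ (a ^ 2) ^ 2 := by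
    nlinarith [mul_nonneg (sq_nonneg (a ^ 2)) (sub_nonneg.2 ha1)]
  -- With monomials as atoms, a quadratic problem in the squares on `A + B + D + E ≤ 1` remains.
  generalize a * b * d = x at *
  generalize a ^ 2 * e = y at *
  generalize a ^ 3 * d = z at *
  generalize a ^ 4 * b = t at *
  generalize a ^ 6 = u at *
  generalize b ^ 3 = v at *
  generalize b * e = s at *
  have hA := sq_nonneg a
  have hB := sq_nonneg b
  have hD := sq_nonneg d
  have hE := sq_nonneg e
  generalize a ^ 2 = A at *
  generalize b ^ 2 = B at *
  generalize d ^ 2 = D at *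
  generalize e ^ 2 = E at *
  nlinarith [mul_nonneg hA hA, mul_nonneg hA hB, mul_nonneg hA hD, mul_nonneg hA hE,
    mul_nonneg hB hB, mul_nonneg hB hD, mul_nonneg hB hE, mul_nonneg hE hE, mul_nonneg hE hD,
    mul_nonneg hA (sub_nonneg.2 h), mul_nonneg hB (sub_nonneg.2 h), mul_nonneg hE (sub_nonneg.2 h)]

theorem norm_hankelPoly_le_one {c₁ c₂ c₃ c₄ : ℂ}
    (h : ‖c₁‖ ^ 2 + ‖c₂‖ ^ 2 + ‖c₃‖ ^ 2 + ‖c₄‖ ^ 2 ≤ 1) : ‖hankelPoly c₁ c₂ c₃ c₄‖ ≤ 1 := by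
  refine le_trans ?_ (hankel_majorant_le_one h)
  unfold hankelPoly
  refine (norm_sub_le _ _).trans (add_le_add ?_ (by simp))
  refine (norm_add_le _ _).trans (add_le_add ?_ (by simp))
  refine (norm_add_le _ _).trans (add_le_add ?_ (by simp))
  refine (norm_sub_le _ _).trans (add_le_add ?_ (by simp))
  refine (norm_sub_le _ _).trans (add_le_add ?_ (by simp))
  refine (norm_add_le _ _).trans (add_le_add ?_ (by simp))
  refine (norm_sub_le _ _).trans (add_le_add ?_ (by simp))
  exact (norm_add_le _ _).trans (add_le_add (by simp) (by simp))

end BeanConvex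

/-! ### Gutzmer's inequality via Parseval. -/

namespace BeanConvex

open MeasureTheory

theorem taylorCoeff_mul_pow_eq_fourierCoeffOn {w : ℂ → ℂ} {r : ℝ} (hr : 0 < r)
    (hw : DifferentiableOn ℂ w (Metric.closedBall 0 r)) (n : ℕ) :
    fourierCoeffOn Real.two_pi_pos (fun θ => w (circleMap 0 r θ)) n
      = taylorCoeff w n * (r : ℂ) ^ n := by
  have h := hw.circleIntegral_one_div_sub_center_pow_smul hr n
  have hr' : (r : ℂ) ≠ 0 := by exact_mod_cast hr.ne'
  have hpi : (Real.pi : ℂ) ≠ 0 := by exact_mod_cast Real.pi_ne_zero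
  rw [fourierCoeffOn_eq_integral]
  -- On the circle `dz = i z dθ`, so Cauchy's integrand for the `n`-th derivative is a Fourier
  -- integrand up to `i / rⁿ`.
  have key : ∀ θ : ℝ, deriv (circleMap 0 r) θ • (1 / (circleMap 0 r θ - 0) ^ (n + 1)) •
      w (circleMap 0 r θ) = (Complex.I / (r : ℂ) ^ n) *
        (fourier (-(n : ℤ)) (θ : AddCircle (2 * Real.pi - 0)) • w (circleMap 0 r θ)) := by
    intro θ
    rw [fourier_coe_apply]
    have he : Complex.exp (2 * Real.pi * Complex.I * ((-(n : ℤ) : ℤ) : ℂ) * θ /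
        ((2 * Real.pi - 0 : ℝ) : ℂ)) = (Complex.exp (θ * Complex.I) ^ n)⁻¹ := by
      rw [← Complex.exp_nat_mul, ← Complex.exp_neg]
      congr 1
      push_cast
      field_simp
      ring
    rw [he]
    have hne := Complex.exp_ne_zero (θ * Complex.I)
    simp only [deriv_circleMap, circleMap, zero_add, sub_zero, smul_eq_mul]
    field_simp
    rw [mul_pow, pow_succ]
    ring
  rw [circleIntegral] at h
  simp_rw [key] at h
  rw [intervalIntegral.integral_const_mul] at h
  rw [Complex.real_smul]
  have hI := Complex.I_ne_zero
  have hf : (n.factorial : ℂ) ≠ 0 := by exact_mod_cast n.factorial_ne_zero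
  unfold taylorCoeff
  simp only [smul_eq_mul] at h ⊢
  push_cast
  field_simp at h ⊢
  simp only [sub_zero] at h ⊢
  linear_combination h

/-- **Gutzmer's inequality** for bounded analytic functions on the unit disk. -/
theorem sum_norm_taylorCoeff_sq_le_one {w : ℂ → ℂ} (hw : DifferentiableOn ℂ w unitDisk)
    (hb : ∀ z ∈ unitDisk, ‖w z‖ ≤ 1) (N : ℕ) :
    ∑ n ∈ Finset.range N, ‖taylorCoeff w n‖ ^ 2 ≤ 1 := by
  -- Parseval needs a circle inside the disk, as `w` may have no boundary values; then `r → 1`.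
  have main : ∀ r : ℝ, 0 < r → r < 1 →
      ∑ n ∈ Finset.range N, (‖taylorCoeff w n‖ * r ^ n) ^ 2 ≤ 1 := by
    intro r hr hr1
    have hsub : Metric.closedBall (0 : ℂ) r ⊆ unitDisk := Metric.closedBall_subset_ball hr1
    have hmem : ∀ θ, circleMap 0 r θ ∈ unitDisk := fun θ =>
      hsub (circleMap_mem_closedBall 0 hr.le θ)
    have hcont : Continuous fun θ => w (circleMap 0 r θ) :=
      hw.continuousOn.comp_continuous (continuous_circleMap 0 r) hmem
    have hL2 : MemLp (fun θ => w (circleMap 0 r θ)) 2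
        (volume.restrict (Set.Ioc 0 (2 * Real.pi))) :=
      MemLp.of_bound hcont.aestronglyMeasurable 1 (.of_forall fun θ => hb _ (hmem θ))
    have hs := hasSum_sq_fourierCoeffOn Real.two_pi_pos hL2
    have h1 : (2 * Real.pi - 0)⁻¹ • ∫ x in (0 : ℝ)..2 * Real.pi, ‖w (circleMap 0 r x)‖ ^ 2 ≤ 1 := by
      have h2 : ∫ x in (0 : ℝ)..2 * Real.pi, ‖w (circleMap 0 r x)‖ ^ 2 ≤
          ∫ _ in (0 : ℝ)..2 * Real.pi, (1 : ℝ) :=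
        intervalIntegral.integral_mono_on Real.two_pi_pos.le
          ((hcont.norm.pow 2).intervalIntegrable _ _) (by simp)
          fun θ _ => pow_le_one₀ (norm_nonneg _) (hb _ (hmem θ))
      rw [intervalIntegral.integral_const] at h2
      rw [smul_eq_mul, inv_mul_le_iff₀ (by simpa using Real.pi_pos)]
      simpa using h2
    refine le_trans ?_ h1
    -- Dropping the other frequencies suffices; the negative ones need not be shown to vanish.
    have h3 := sum_le_hasSum ((Finset.range N).map ⟨((↑) : ℕ → ℤ), Nat.cast_injective⟩)
      (fun _ _ => by positivity) hs
    refine le_of_eq_of_le ?_ h3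
    rw [Finset.sum_map]
    refine Finset.sum_congr rfl fun n _ => ?_
    simp only [Function.Embedding.coeFn_mk]
    rw [taylorCoeff_mul_pow_eq_fourierCoeffOn hr (hw.mono hsub)]
    simp [abs_of_pos hr]
  have ht : Filter.Tendsto (fun r : ℝ => ∑ n ∈ Finset.range N, (‖taylorCoeff w n‖ * r ^ n) ^ 2)
      (nhdsWithin 1 (Set.Iio 1)) (nhds (∑ n ∈ Finset.range N, (‖taylorCoeff w n‖ * 1 ^ n) ^ 2)) :=
    (Continuous.tendsto (by fun_prop) 1).mono_left nhdsWithin_le_nhds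
  simp only [one_pow, mul_one] at ht
  refine le_of_tendsto ht ?_
  filter_upwards [Ioo_mem_nhdsLT (zero_lt_one (α := ℝ))] with r hr using main r hr.1 hr.2

end BeanConvex

/-! ### Taylor expansion as a differential ring map from germs to power series. -/

namespace BeanConvex

/-- The Taylor series at the origin, as a formal power series. -/
noncomputable def taylorSeries (f : ℂ → ℂ) : PowerSeries ℂ := PowerSeries.mk (taylorCoeff f)

theorem coeff_taylorSeries (f : ℂ → ℂ) (n : ℕ) :
    PowerSeries.coeff n (taylorSeries f) = taylorCoeff f n := PowerSeries.coeff_mk _ _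

theorem taylorCoeff_zero (f : ℂ → ℂ) : taylorCoeff f 0 = f 0 := by simp [taylorCoeff]

theorem taylorCoeff_one (f : ℂ → ℂ) : taylorCoeff f 1 = deriv f 0 := by simp [taylorCoeff]

theorem taylorSeries_congr {f g : ℂ → ℂ} (h : f =ᶠ[nhds 0] g) :
    taylorSeries f = taylorSeries g := by
  ext n
  rw [coeff_taylorSeries, coeff_taylorSeries, taylorCoeff, taylorCoeff, h.iteratedDeriv_eq]

theorem taylorSeries_const (c : ℂ) : taylorSeries (fun _ => c) = PowerSeries.C c := by
  ext n
  rw [coeff_taylorSeries, taylorCoeff, iteratedDeriv_const, PowerSeries.coeff_C]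
  split_ifs with h <;> simp [h]

theorem taylorSeries_id : taylorSeries (fun z => z) = PowerSeries.X := by
  ext n
  rw [coeff_taylorSeries, taylorCoeff, iteratedDeriv_fun_id, PowerSeries.coeff_X]
  obtain rfl | hn := eq_or_ne n 1
  · simp
  · simp [hn]

theorem taylorSeries_add {f g : ℂ → ℂ} (hf : AnalyticAt ℂ f 0) (hg : AnalyticAt ℂ g 0) :
    taylorSeries (fun z => f z + g z) = taylorSeries f + taylorSeries g := by
  ext n
  rw [map_add]
  simp only [coeff_taylorSeries, taylorCoeff]
  rw [iteratedDeriv_fun_add hf.contDiffAt hg.contDiffAt, add_div]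

theorem taylorSeries_sub {f g : ℂ → ℂ} (hf : AnalyticAt ℂ f 0) (hg : AnalyticAt ℂ g 0) :
    taylorSeries (fun z => f z - g z) = taylorSeries f - taylorSeries g := by
  ext n
  rw [map_sub]
  simp only [coeff_taylorSeries, taylorCoeff]
  rw [iteratedDeriv_fun_sub hf.contDiffAt hg.contDiffAt, sub_div]

theorem taylorSeries_mul {f g : ℂ → ℂ} (hf : AnalyticAt ℂ f 0) (hg : AnalyticAt ℂ g 0) :
    taylorSeries (fun z => f z * g z) = taylorSeries f * taylorSeries g := by
  ext n
  rw [PowerSeries.coeff_mul, Finset.Nat.sum_antidiagonal_eq_sum_range_succ_mk]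
  simp only [coeff_taylorSeries, taylorCoeff]
  rw [iteratedDeriv_fun_mul hf.contDiffAt hg.contDiffAt, Finset.sum_div]
  refine Finset.sum_congr rfl fun i hi => ?_
  have hi' : i ≤ n := Nat.lt_succ_iff.1 (Finset.mem_range.1 hi)
  rw [Nat.cast_choose ℂ hi']
  have h1 : (n.factorial : ℂ) ≠ 0 := by exact_mod_cast n.factorial_ne_zero
  have h2 : (i.factorial : ℂ) ≠ 0 := by exact_mod_cast i.factorial_ne_zero
  have h3 : ((n - i).factorial : ℂ) ≠ 0 := by exact_mod_cast (n - i).factorial_ne_zero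
  field_simp

theorem taylorSeries_deriv (f : ℂ → ℂ) :
    taylorSeries (deriv f) = PowerSeries.derivative ℂ (taylorSeries f) := by
  ext n
  rw [PowerSeries.coeff_derivative]
  simp only [coeff_taylorSeries, taylorCoeff]
  rw [← iteratedDeriv_succ', Nat.factorial_succ]
  have h1 : (n.factorial : ℂ) ≠ 0 := by exact_mod_cast n.factorial_ne_zero
  have h2 : (n : ℂ) + 1 ≠ 0 := by exact_mod_cast n.succ_ne_zero
  push_cast
  field_simp

end BeanConvex

/-! ### Comparison of coefficients. -/

namespace BeanConvex

-- Formal version with `T = tanh W`, `Q = √(1 + T)`: the differential equation of `tanh` replaces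
-- composition, and `coeff 0 Q = 1` selects the branch. The resulting system is triangular.
open PowerSeries in
theorem hankelPoly_of_powerSeries {F Q T W : PowerSeries ℂ}
    (hQ : Q * Q = 1 + T) (hT : derivative ℂ T = (1 - T * T) * derivative ℂ W)
    (hF : derivative ℂ F * (Q - 1) = X * derivative ℂ (derivative ℂ F))
    (hQ0 : coeff 0 Q = 1) (hT0 : coeff 0 T = 0) (hF1 : coeff 1 F = 1) :
    576 * (2 * coeff 2 F * coeff 3 F * coeff 4 F - coeff 3 F ^ 3 - coeff 4 F ^ 2
        - coeff 2 F ^ 2 * coeff 5 F + coeff 3 F * coeff 5 F)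
      = hankelPoly (coeff 1 W) (coeff 2 W) (coeff 3 W) (coeff 4 W) := by
  have t (n : ℕ) := congrArg (coeff n) hT
  have q (n : ℕ) := congrArg (coeff n) hQ
  -- The shift absorbs the factor `X`; since `Q - 1` has no constant term, equation `n` determines
  -- `coeff (n + 2) F`.
  have f (n : ℕ) := congrArg (coeff (n + 1)) hF
  simp only [coeff_succ_X_mul] at f
  have t0 := t 0
  have t1 := t 1
  have t2 := t 2
  have t3 := t 3
  have q1 := q 1
  have q2 := q 2
  have q3 := q 3
  have q4 := q 4
  have f0 := f 0
  have f1 := f 1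
  have f2 := f 2
  have f3 := f 3
  clear t q f hQ hT hF
  simp only [coeff_mul, coeff_derivative, coeff_one, map_add, map_sub,
    Finset.Nat.antidiagonal_succ, Finset.Nat.antidiagonal_zero, Finset.sum_cons,
    Finset.sum_singleton, Finset.map_cons, Finset.map_singleton,
    Function.Embedding.coe_prodMap, Function.Embedding.coeFn_mk, Prod.map_apply,
    Function.Embedding.refl_apply, Nat.succ_eq_add_one, zero_add, Nat.reduceAdd,
    OfNat.ofNat_ne_zero, one_ne_zero, if_true, if_false, hQ0, hT0, hF1]
    at t0 t1 t2 t3 q1 q2 q3 q4 f0 f1 f2 f3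
  push_cast at t0 t1 t2 t3 q1 q2 q3 q4 f0 f1 f2 f3
  generalize coeff 1 W = c₁ at *
  generalize coeff 2 W = c₂ at *
  generalize coeff 3 W = c₃ at *
  generalize coeff 4 W = c₄ at *
  generalize coeff 1 T = T₁ at *
  generalize coeff 2 T = T₂ at *
  generalize coeff 3 T = T₃ at *
  generalize coeff 4 T = T₄ at *
  generalize coeff 1 Q = Q₁ at *
  generalize coeff 2 Q = Q₂ at *
  generalize coeff 3 Q = Q₃ at *
  generalize coeff 4 Q = Q₄ at *
  -- After these substitutions `T₁` and `T₂` stand for `c₁` and `c₂`.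
  obtain rfl : T₁ = c₁ := by linear_combination t0
  obtain rfl : T₂ = c₂ := by linear_combination t1 / 2
  obtain rfl : T₃ = c₃ - T₁ ^ 3 / 3 := by linear_combination t2 / 3
  obtain rfl : T₄ = c₄ - T₁ ^ 2 * T₂ := by linear_combination t3 / 4
  obtain rfl : Q₁ = T₁ / 2 := by linear_combination q1 / 2
  obtain rfl : Q₂ = T₂ / 2 - T₁ ^ 2 / 8 := by linear_combination q2 / 2
  obtain rfl : Q₃ = c₃ / 2 - T₁ * T₂ / 4 - 5 / 48 * T₁ ^ 3 := by linear_combination q3 / 2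
  obtain rfl : Q₄ = c₄ / 2 - (2 * T₁ * c₃ + T₂ ^ 2) / 8 - 5 / 16 * T₁ ^ 2 * T₂
      + 17 / 384 * T₁ ^ 4 := by linear_combination q4 / 2
  have h2 : coeff 2 F = T₁ / 4 := by linear_combination -f0 / 2
  rw [h2] at f1 f2 f3 ⊢
  have h3 : coeff 3 F = T₁ ^ 2 / 48 + T₂ / 12 := by linear_combination -f1 / 6
  rw [h3] at f2 f3 ⊢
  have h4 : coeff 4 F = -13 / 1152 * T₁ ^ 3 + T₁ * T₂ / 96 + c₃ / 24 := by
    linear_combination -f2 / 12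
  rw [h4] at f3 ⊢
  have h5 : coeff 5 F = -11 / 5760 * T₁ ^ 4 - T₁ ^ 2 * T₂ / 48 + T₁ * c₃ / 240 + c₄ / 40 := by
    linear_combination -f3 / 20
  rw [h5, hankelPoly]
  ring

end BeanConvex

/-! ### Analyticity of the bean map and the upper bound. -/

namespace BeanConvex

open Complex

theorem isOpen_unitDisk : IsOpen unitDisk := Metric.isOpen_ball

theorem unitDisk_mem_nhds_zero : unitDisk ∈ nhds 0 := Metric.ball_mem_nhds 0 one_pos

theorem zero_mem_unitDisk : (0 : ℂ) ∈ unitDisk := Metric.mem_ball_self one_pos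

/-- Holds because `|Im 2z| < 2 < π`. A zero of `cosh`, or a value `1 + tanh z = t ≤ 0`, would force
`exp (2z)` to be `-1` or `t / (2 - t)`, both on the cut. -/
theorem exp_two_mul_mem_slitPlane {z : ℂ} (hz : z ∈ unitDisk) : exp (2 * z) ∈ slitPlane := by
  have hz' : |z.im| < 1 := (abs_im_le_norm z).trans_lt (by simpa [unitDisk] using hz)
  have hpi := Real.pi_gt_three
  rw [abs_lt] at hz'
  rw [mem_slitPlane_iff_arg]
  refine ⟨?_, exp_ne_zero _⟩
  have h2 : (2 * z).im = 2 * z.im := by simp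
  rw [arg_exp, (toIocMod_eq_self Real.two_pi_pos).2 ⟨by linarith, by linarith⟩, h2]
  linarith

theorem cosh_ne_zero_of_mem_unitDisk {z : ℂ} (hz : z ∈ unitDisk) : cosh z ≠ 0 := by
  intro h
  have he : exp (2 * z) = ((-1 : ℝ) : ℂ) := by
    have h1 := exp_ne_zero z
    rw [Complex.cosh, exp_neg] at h
    rw [two_mul, exp_add]
    field_simp at h
    push_cast
    linear_combination h
  have := exp_two_mul_mem_slitPlane hz
  rw [he, ofReal_mem_slitPlane] at this
  linarith

theorem one_add_tanh_mem_slitPlane {z : ℂ} (hz : z ∈ unitDisk) : 1 + tanh z ∈ slitPlane := by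
  by_contra hn
  have hc := cosh_ne_zero_of_mem_unitDisk hz
  obtain ⟨t, ht, hzt⟩ : ∃ t : ℝ, t ≤ 0 ∧ 1 + tanh z = t := by
    rw [mem_slitPlane_iff] at hn
    push Not at hn
    exact ⟨_, hn.1, Complex.ext rfl (by simpa using hn.2)⟩
  have he : exp (2 * z) = ((t / (2 - t) : ℝ) : ℂ) := by
    have h1 := exp_ne_zero z
    have h2 : ((2 - t : ℝ) : ℂ) ≠ 0 := by
      rw [Ne, ofReal_eq_zero]
      linarith
    rw [Complex.tanh, ← sub_eq_zero] at hzt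
    field_simp at hzt
    rw [Complex.cosh, Complex.sinh, exp_neg] at hzt
    field_simp at hzt
    push_cast at h2 ⊢
    rw [eq_div_iff h2, two_mul, exp_add]
    linear_combination hzt
  have := exp_two_mul_mem_slitPlane hz
  rw [he, ofReal_mem_slitPlane] at this
  exact absurd this (not_lt.2 (div_nonpos_of_nonpos_of_nonneg ht (by linarith)))

theorem hasDerivAt_tanh {z : ℂ} (hz : z ∈ unitDisk) : HasDerivAt tanh (1 - tanh z * tanh z) z := by
  have hc := cosh_ne_zero_of_mem_unitDisk hz
  have h := (Complex.hasDerivAt_sinh z).div (Complex.hasDerivAt_cosh z) hc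
  refine (h.congr_of_eventuallyEq (.of_forall fun x => ?_)).congr_deriv ?_
  · exact Complex.tanh_eq_sinh_div_cosh x
  · rw [Complex.tanh_eq_sinh_div_cosh]
    field_simp

theorem differentiableOn_beanMap : DifferentiableOn ℂ beanMap unitDisk := fun z hz =>
  ((differentiableAt_sqrt (one_add_tanh_mem_slitPlane hz)).comp z
    ((hasDerivAt_tanh hz).differentiableAt.const_add 1)).differentiableWithinAt

theorem beanMap_mul_self (z : ℂ) : beanMap z * beanMap z = 1 + tanh z := by
  rw [beanMap, Complex.sqrt, ← sq]
  exact_mod_cast cpow_nat_inv_pow (1 + tanh z) two_ne_zero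

theorem beanMap_zero : beanMap 0 = 1 := by simp [beanMap]

namespace IsSchwarz

theorem mapsTo {w : ℂ → ℂ} (hw : IsSchwarz w) :
    Set.MapsTo w unitDisk unitDisk := fun z hz => by
  have h := hw.2.2 z hz
  simp only [unitDisk, mem_ball_zero_iff] at hz ⊢
  exact h.trans_lt hz

theorem sum_norm_sq_le_one {w : ℂ → ℂ} (hw : IsSchwarz w) :
    ‖taylorCoeff w 1‖ ^ 2 + ‖taylorCoeff w 2‖ ^ 2
    + ‖taylorCoeff w 3‖ ^ 2 + ‖taylorCoeff w 4‖ ^ 2 ≤ 1 := by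
  have h := sum_norm_taylorCoeff_sq_le_one hw.1
    (fun z hz => (mem_ball_zero_iff.1 (hw.mapsTo hz)).le) 5
  simpa [Finset.sum_range_succ, taylorCoeff_zero, hw.2.1] using h

end IsSchwarz

theorem hankelDet_three_one (f : ℂ → ℂ) : hankelDet 3 1 f =
    taylorCoeff f 1 * taylorCoeff f 3 * taylorCoeff f 5 - taylorCoeff f 1 * taylorCoeff f 4 ^ 2
      - taylorCoeff f 2 ^ 2 * taylorCoeff f 5 + 2 * taylorCoeff f 2 * taylorCoeff f 3 *
      taylorCoeff f 4 - taylorCoeff f 3 ^ 3 := by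
  simp [hankelDet, Matrix.det_fin_three]
  ring

theorem hankelDet_eq_hankelPoly {f w : ℂ → ℂ} (hf : f ∈ ClassA) (hw : IsSchwarz w)
    (h : ∀ z ∈ unitDisk, 1 + z * deriv (deriv f) z / deriv f z = beanMap (w z)) :
    576 * hankelDet 3 1 f = hankelPoly (taylorCoeff w 1) (taylorCoeff w 2) (taylorCoeff w 3)
      (taylorCoeff w 4) := by
  have hwd : ∀ z ∈ unitDisk, DifferentiableAt ℂ w z := fun z hz =>
    hw.1.differentiableAt (isOpen_unitDisk.mem_nhds hz)
  have hderiv : ∀ z ∈ unitDisk, HasDerivAt (fun z => tanh (w z))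
      ((1 - tanh (w z) * tanh (w z)) * deriv w z) z := fun z hz =>
    (hasDerivAt_tanh (hw.mapsTo hz)).comp z (hwd z hz).hasDerivAt
  have aw : AnalyticAt ℂ w 0 := hw.1.analyticAt unitDisk_mem_nhds_zero
  have af : AnalyticAt ℂ f 0 := hf.1.analyticAt unitDisk_mem_nhds_zero
  have aT : AnalyticAt ℂ (fun z => tanh (w z)) 0 :=
    DifferentiableOn.analyticAt (s := unitDisk)
      (fun z hz => (hderiv z hz).differentiableAt.differentiableWithinAt) unitDisk_mem_nhds_zero
  have aQ : AnalyticAt ℂ (fun z => beanMap (w z)) 0 :=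
    (differentiableOn_beanMap.comp hw.1 hw.mapsTo).analyticAt unitDisk_mem_nhds_zero
  have a1 : AnalyticAt ℂ (fun _ : ℂ => (1 : ℂ)) 0 := analyticAt_const
  have aTT : AnalyticAt ℂ (fun z => tanh (w z) * tanh (w z)) 0 := aT.mul aT
  have key := hankelPoly_of_powerSeries (F := taylorSeries f)
    (Q := taylorSeries fun z => beanMap (w z)) (T := taylorSeries fun z => tanh (w z))
    (W := taylorSeries w) ?_ ?_ ?_ ?_ ?_ ?_
  · simp only [coeff_taylorSeries] at key
    rw [← key, hankelDet_three_one, taylorCoeff_one, hf.2.2]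
    ring
  · rw [← taylorSeries_mul aQ aQ, ← map_one PowerSeries.C, ← taylorSeries_const,
      ← taylorSeries_add a1 aT]
    simp_rw [beanMap_mul_self]
  · rw [← taylorSeries_deriv, ← taylorSeries_deriv, ← map_one PowerSeries.C,
      ← taylorSeries_const, ← taylorSeries_mul aT aT, ← taylorSeries_sub a1 aTT,
      ← taylorSeries_mul (a1.fun_sub aTT) aw.deriv]
    refine taylorSeries_congr ?_
    filter_upwards [unitDisk_mem_nhds_zero] with z hz using (hderiv z hz).deriv
  · rw [← taylorSeries_deriv, ← taylorSeries_deriv, ← map_one PowerSeries.C,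
      ← taylorSeries_const, ← taylorSeries_id, ← taylorSeries_sub aQ a1,
      ← taylorSeries_mul af.deriv (aQ.fun_sub a1),
      ← taylorSeries_mul (f := fun z => z) analyticAt_id af.deriv.deriv]
    refine taylorSeries_congr ?_
    -- Only germs at 0 matter, so possible zeros of `f'` elsewhere in the disk are harmless.
    have hne : ∀ᶠ z in nhds 0, deriv f z ≠ 0 :=
      af.deriv.continuousAt.eventually_ne (by rw [hf.2.2]; exact one_ne_zero)
    filter_upwards [unitDisk_mem_nhds_zero, hne] with z hz hz'
    rw [← h z hz]
    field_simp
    ring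
  · rw [coeff_taylorSeries, taylorCoeff_zero, hw.2.1, beanMap_zero]
  · rw [coeff_taylorSeries, taylorCoeff_zero, hw.2.1, tanh_zero]
  · rw [coeff_taylorSeries, taylorCoeff_one, hf.2.2]

theorem norm_hankelDet_le {f : ℂ → ℂ} (hf : f ∈ ClassCB) : ‖hankelDet 3 1 f‖ ≤ 1 / 576 := by
  obtain ⟨hA, -, -, w, hw, h⟩ := hf
  have h1 := norm_hankelPoly_le_one hw.sum_norm_sq_le_one
  rw [← hankelDet_eq_hankelPoly hA hw h, norm_mul] at h1
  norm_num at h1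
  linarith

end BeanConvex

/-! ### Sharpness. -/

namespace BeanConvex

open Complex

theorem segmentIntegral_zero (g : ℂ → ℂ) : segmentIntegral g 0 = 0 := by simp [segmentIntegral]

/-- A holomorphic function on a disk has a primitive `G`, and integrating along the radius gives `G
z - G 0`. -/
theorem hasDerivAt_segmentIntegral {g : ℂ → ℂ} (hg : DifferentiableOn ℂ g unitDisk) {z : ℂ}
    (hz : z ∈ unitDisk) : HasDerivAt (segmentIntegral g) (g z) z := by
  obtain ⟨G, hG⟩ := hg.isExactOn_ball
  have hGd : ∀ x ∈ unitDisk, HasDerivAt G (g x) x := hG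
  have key : ∀ x ∈ unitDisk, segmentIntegral g x = G x - G 0 := by
    intro x hx
    have hmem : ∀ s ∈ Set.uIcc (0 : ℝ) 1, (s : ℂ) * x ∈ unitDisk := by
      intro s hs
      rw [Set.uIcc_of_le zero_le_one] at hs
      rw [unitDisk, mem_ball_zero_iff] at hx ⊢
      rw [norm_mul, norm_real, Real.norm_of_nonneg hs.1]
      exact (mul_le_of_le_one_left (norm_nonneg x) hs.2).trans_lt hx
    have hline (s : ℝ) : HasDerivAt (fun s : ℝ => (s : ℂ) * x) x s := by
      simpa using (HasDerivAt.ofReal_comp (hasDerivAt_id s)).mul_const x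
    have h1 : ∀ s ∈ Set.uIcc (0 : ℝ) 1,
        HasDerivAt (fun s : ℝ => G ((s : ℂ) * x)) (g ((s : ℂ) * x) * x) s := fun s hs =>
      (hGd _ (hmem s hs)).comp s (hline s)
    have h2 : ContinuousOn (fun s : ℝ => g ((s : ℂ) * x) * x) (Set.uIcc 0 1) :=
      (hg.continuousOn.comp (by fun_prop) hmem).mul continuousOn_const
    have h3 := intervalIntegral.integral_eq_sub_of_hasDerivAt h1 h2.intervalIntegrable
    rw [intervalIntegral.integral_mul_const] at h3
    rw [segmentIntegral, mul_comm, h3]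
    simp
  refine ((hGd z hz).sub_const (G 0)).congr_of_eventuallyEq ?_
  filter_upwards [isOpen_unitDisk.mem_nhds hz] with x hx using key x hx

theorem isSchwarz_cube : IsSchwarz fun z => z ^ 3 := by
  refine ⟨by fun_prop, by simp, fun z hz => ?_⟩
  rw [norm_pow]
  exact pow_le_of_le_one (norm_nonneg z) (mem_ball_zero_iff.1 hz).le three_ne_zero

theorem differentiableOn_beanMap_cube :
    DifferentiableOn ℂ (fun z => beanMap (z ^ 3)) unitDisk :=
  differentiableOn_beanMap.comp isSchwarz_cube.1 isSchwarz_cube.mapsTo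

theorem differentiableOn_beanMap_cube_sub_one_div :
    DifferentiableOn ℂ (fun u => (beanMap (u ^ 3) - 1) / u) unitDisk := by
  -- The quotient is the `dslope` of `beanMap (u ^ 3)` at 0; this derivative is its value there and
  -- matches the default `0 / 0 = 0`.
  have hd : deriv (fun u => beanMap (u ^ 3)) 0 = 0 := by
    have h1 : DifferentiableAt ℂ beanMap (0 ^ 3) := by
      rw [zero_pow three_ne_zero]
      exact differentiableOn_beanMap.differentiableAt unitDisk_mem_nhds_zero
    simpa [Function.comp_def] using (h1.hasDerivAt.comp (0 : ℂ) (hasDerivAt_pow 3 (0 : ℂ))).deriv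
  refine ((differentiableOn_dslope unitDisk_mem_nhds_zero).2
    differentiableOn_beanMap_cube).congr fun u _ => ?_
  obtain rfl | hu := eq_or_ne u 0
  · simp [hd]
  · rw [dslope_of_ne _ hu, slope_def_field]
    simp [beanMap_zero]

theorem hasDerivAt_extremalFun {z : ℂ} (hz : z ∈ unitDisk) : HasDerivAt extremalFun
    (exp (segmentIntegral (fun u => (beanMap (u ^ 3) - 1) / u) z)) z := by
  refine hasDerivAt_segmentIntegral (fun x hx => ?_) hz
  exact (hasDerivAt_segmentIntegral differentiableOn_beanMap_cube_sub_one_div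
    hx).cexp.differentiableAt.differentiableWithinAt

theorem extremalFun_mem_classA : extremalFun ∈ ClassA := by
  refine ⟨fun z hz => (hasDerivAt_extremalFun hz).differentiableAt.differentiableWithinAt,
    segmentIntegral_zero _, ?_⟩
  rw [(hasDerivAt_extremalFun zero_mem_unitDisk).deriv, segmentIntegral_zero, exp_zero]

theorem one_add_mul_deriv_deriv_extremalFun_div {z : ℂ} (hz : z ∈ unitDisk) :
    1 + z * deriv (deriv extremalFun) z / deriv extremalFun z = beanMap (z ^ 3) := by
  have h1 : deriv extremalFun =ᶠ[nhds z]
      fun x => exp (segmentIntegral (fun u => (beanMap (u ^ 3) - 1) / u) x) := by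
    filter_upwards [isOpen_unitDisk.mem_nhds hz] with x hx using (hasDerivAt_extremalFun hx).deriv
  rw [h1.deriv_eq, h1.eq_of_nhds,
    (hasDerivAt_segmentIntegral differentiableOn_beanMap_cube_sub_one_div hz).cexp.deriv]
  have he := exp_ne_zero (segmentIntegral (fun u => (beanMap (u ^ 3) - 1) / u) z)
  obtain rfl | h0 := eq_or_ne z 0
  · simp [beanMap_zero]
  · field_simp
    ring

theorem extremalFun_mem_classCB : extremalFun ∈ ClassCB := by
  refine ⟨extremalFun_mem_classA, ?_, differentiableOn_beanMap, _, isSchwarz_cube,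
    fun z hz => one_add_mul_deriv_deriv_extremalFun_div hz⟩
  exact differentiableOn_beanMap_cube.congr fun z hz => one_add_mul_deriv_deriv_extremalFun_div hz

theorem norm_hankelDet_extremalFun : ‖hankelDet 3 1 extremalFun‖ = 1 / 576 := by
  have h := hankelDet_eq_hankelPoly extremalFun_mem_classA isSchwarz_cube
    fun z hz => one_add_mul_deriv_deriv_extremalFun_div hz
  have hc (n : ℕ) : taylorCoeff (fun z => z ^ 3) n = if n = 3 then 1 else 0 := by
    rw [taylorCoeff, iteratedDeriv_fun_pow_zero]
    split_ifs with hn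
    · subst hn
      norm_num [Nat.factorial]
    · simp
  -- Only `-c₃²` survives when `w = z³`.
  have h1 : hankelDet 3 1 extremalFun = -(1 / 576) := by
    simp only [hc, hankelPoly] at h
    norm_num at h
    linear_combination h / 576
  rw [h1]
  norm_num

end BeanConvex

theorem mainTheorem3 :
    (∀ f ∈ BeanConvex.ClassCB, ‖BeanConvex.hankelDet 3 1 f‖ ≤ 1 / 576) ∧
      BeanConvex.extremalFun ∈ BeanConvex.ClassCB ∧
      ‖BeanConvex.hankelDet 3 1 BeanConvex.extremalFun‖ = 1 / 576 :=
  ⟨fun _ hf => BeanConvex.norm_hankelDet_le hf, BeanConvex.extremalFun_mem_classCB,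
    BeanConvex.norm_hankelDet_extremalFun⟩
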